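/- A one-pass (online) nondeterministic Turing machine has a finite state set, a read-only input tape over $\{0,1\}$ whose head starts on the first input bit and in each step moves one cell to the right or stays put (the machine can recognise the end of the input), and a work tape over $\{0,1\}$, infinite to the right and initially filled with zeros, whose head starts on the first cell and can move in both directions (a left move from the first cell leaves it in place). The available actions depend on the state and the two scanned symbols; the machine halts when no action is available, and it is deterministic if at most one action is ever available. It accepts the language $\mathbf{L}\subseteq\{0,1\}^*$ of those inputs on which some computation halts in an accepting state. It uses space $s(n)$, where $s:\mathbb N\to\mathbb N$, if for every $n$ and every input of length $n$ every computation visits only the first $s(n)$ work cells (the cell scanned at the start counts, so $s(n)\ge 1$). For a polytope $P$ let $\mathrm{xc}(P)$ be the smallest $r$ such that $P$ is the image under an affine map of a polytope described by $r$ linear inequalities. For $\mathbf{L}\subseteq\{0,1\}^*$ let $P(\mathbf{L}(n))\subseteq\mathbb R^n$ be the convex hull of the strings of length $n$ in $\mathbf{L}$, viewed as zero-one vectors. Write $\mathrm{xc}(\mathbf{L})=\mathcal O(f)$ if there are a constant $c>0$ and $n_0\in\mathbb N$ with $\mathrm{xc}(P(\mathbf{L}(n)))\le c\,f(n)$ for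 all $n\ge n_0$. **Theorem.** If $\mathbf{L}$ is accepted by a one-pass nondeterministic Turing machine using space $s(n)$, then $$\mathrm{xc}(\mathbf{L})=\mathcal O\bigl(4^{s(n)}\,s(n)^2\cdot n\bigr).$$ If $\mathbf{L}$ is accepted by a one-pass deterministic Turing machine using space $s(n)$, then $$\mathrm{xc}(\mathbf{L})=\mathcal O\bigl(2^{s(n)}\,s(n)\cdot n\bigr).$$ -/

import Mathlib

open scoped NNReal ENNReal Matrix

/-! ## Extension complexity of polytopes -/

/-- The solution set of the system of `r` linear inequalities `A y ≤ b` in `ℝ^m`. -/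
def polyhedron {r m : ℕ} (A : Matrix (Fin r) (Fin m) ℝ) (b : Fin r → ℝ) : Set (Fin m → ℝ) :=
  {y | A *ᵥ y ≤ b}

/-- `P` has an extended formulation of size at most `r`: it is the image under an affine projection
of a polytope (a bounded polyhedron) that is described by `r` linear inequalities. -/
def HasExtendedFormulation {d : ℕ} (P : Set (Fin d → ℝ)) (r : ℕ) : Prop :=
  ∃ (m : ℕ) (A : Matrix (Fin r) (Fin m) ℝ) (b : Fin r → ℝ)
    (π : (Fin m → ℝ) →ᵃ[ℝ] (Fin d → ℝ)),
    Bornology.IsBounded (polyhedron A b) ∧ π '' polyhedron A b = P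

/-- The extension complexity of `P`: the least size of an extended formulation of `P`
(`⊤` if there is none, i.e. if `P` is not a polytope). -/
noncomputable def xc {d : ℕ} (P : Set (Fin d → ℝ)) : ℕ∞ :=
  ⨅ r ∈ {r : ℕ | HasExtendedFormulation P r}, (r : ℕ∞)

/-! ## Extension complexity of languages -/

/-- A binary string of length `n` as a zero-one vector in `ℝ^n`. -/
def bitVector {n : ℕ} (x : Fin n → Bool) : Fin n → ℝ :=
  fun i => if x i then 1 else 0

/-- `P(L(n))`, the convex hull of the strings of length `n` in the language `L`. -/
def languagePolytope (L : Language Bool) (n : ℕ) : Set (Fin n → ℝ) :=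
  convexHull ℝ (bitVector '' {x : Fin n → Bool | List.ofFn x ∈ L})

/-- `xc(L) = O(f)`. -/
def XcIsBigO (L : Language Bool) (f : ℕ → ℝ≥0) : Prop :=
  ∃ c : ℝ≥0, 0 < c ∧ ∃ n₀ : ℕ, ∀ n : ℕ, n₀ ≤ n →
    ((xc (languagePolytope L n) : ℕ∞) : ℝ≥0∞) ≤ ((c * f n : ℝ≥0) : ℝ≥0∞)

/-! ## One-pass (online) Turing machines -/

/-- Moves of the head on the work tape. -/
inductive WorkMove where
  | left
  | stay
  | right

/-- The new position of the work head. The work tape is infinite to the right only; a left move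
from its first cell leaves the head where it is. -/
def WorkMove.apply : WorkMove → ℕ → ℕ
  | .left, i => i - 1
  | .stay, i => i
  | .right, i => i + 1

/-- Moves of the head on the one-way input tape. -/
inductive InputMove where
  | stay
  | right

/-- The part of the input from the new head position on; past the end of the input the tape
is blank. -/
def InputMove.apply : InputMove → List Bool → List Bool
  | .stay, x => x
  | .right, x => x.tail

/-- What a machine with state set `Q` does in one step: the next state, the bit written into the
scanned work cell, and the moves of the two heads. -/
structure TMAction (Q : Type) where
  state : Q
  write : Bool
  workMove : WorkMove
  inputMove : InputMove

/-- A nondeterministic one-pass Turing machine with a one-way read-only input tape over `{0,1}` and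
a work tape over `{0,1}`. The available actions depend on the state, the scanned input symbol
(`none` past the end of the input), and the scanned work bit. -/
structure OnlineTM where
  State : Type
  finite_state : Finite State
  start : State
  accepting : Set State
  trans : State → Option Bool → Bool → Set (TMAction State)

namespace OnlineTM

/-- A configuration: the state, the input from the input head on, the content of the work tape,
and the position of the work head. -/
structure Config (M : OnlineTM) where
  state : M.State
  input : List Bool
  tape : ℕ → Bool
  head : ℕ

variable (M : OnlineTM)

/-- The initial configuration on input `x`; the work tape is filled with zeros. -/
def init (x : List Bool) : M.Config where
  state := M.start
  input := x
  tape := fun _ => false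
  head := 0

/-- The actions available in a configuration. -/
def actions (c : M.Config) : Set (TMAction M.State) :=
  M.trans c.state c.input.head? (c.tape c.head)

/-- The configuration that an action leads to. -/
def next (c : M.Config) (a : TMAction M.State) : M.Config where
  state := a.state
  input := a.inputMove.apply c.input
  tape := Function.update c.tape c.head a.write
  head := a.workMove.apply c.head

/-- One step of the computation. -/
def Step (c c' : M.Config) : Prop :=
  ∃ a ∈ M.actions c, M.next c a = c'

/-- `c` occurs in some computation on input `x`. -/
def Reaches (x : List Bool) (c : M.Config) : Prop :=
  Relation.ReflTransGen M.Step (M.init x) c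

/-- The machine halts in `c`: no action is available. -/
def Halted (c : M.Config) : Prop :=
  M.actions c = ∅

/-- Some computation on input `x` halts in an accepting state. -/
def Accepts (x : List Bool) : Prop :=
  ∃ c : M.Config, M.Reaches x c ∧ M.Halted c ∧ c.state ∈ M.accepting

/-- The language accepted by `M`. -/
def language : Language Bool :=
  {x | M.Accepts x}

/-- On inputs of length `n`, no computation visits a work cell outside the first `s n`. -/
def UsesSpace (s : ℕ → ℕ) : Prop :=
  ∀ (x : List Bool) (c : M.Config), M.Reaches x c → c.head < s x.length

/-- At most one action is available in every situation. -/
def Deterministic : Prop :=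
  ∀ (q : M.State) (a : Option Bool) (b : Bool), (M.trans q a b).Subsingleton

end OnlineTM

/-- The languages accepted by one-pass nondeterministic Turing machines using space `s(n)`. -/
def OnePassNSPACE (s : ℕ → ℕ) : Set (Language Bool) :=
  {L | ∃ M : OnlineTM, M.UsesSpace s ∧ M.language = L}

/-- The languages accepted by one-pass deterministic Turing machines using space `s(n)`. -/
def OnePassDSPACE (s : ℕ → ℕ) : Set (Language Bool) :=
  {L | ∃ M : OnlineTM, M.Deterministic ∧ M.UsesSpace s ∧ M.language = L}

/-! ## Extended formulations from affine sections of the nonnegative orthant -/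

/-! Since the input head never returns, what a run remembers of the bits already passed is only its
state, work tape and work head: at most `|Q| * (2 ^ s * s)` work configurations. Contracting all
steps made on one input bit into a single transition gives a finite automaton with one extra
absorbing state for early acceptance (`accepts_iff_boundedAccepts`). Unrolled over `n` layers, its
accepting paths are labelled exactly by the words of `L(n)`. Every nonnegative unit flow in this
acyclic network is a convex combination of paths (`exists_mem_convexHull_pathWords`), so the flow
polytope projects onto `P(L(n))`. Conservation laws are equations and cost nothing; only
nonnegativity of each of the `n * |E|` arc variables counts
(`exists_hasExtendedFormulation_of_orthant_section`). In general `|E|` is at most twice the square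
of the number of states. For a deterministic machine a state and a bit determine the transition
(`bitStep_unique`), and the bound becomes linear. -/

theorem hasExtendedFormulation_empty {d : ℕ} :
    HasExtendedFormulation (∅ : Set (Fin d → ℝ)) 1 := by
  have h : polyhedron (0 : Matrix (Fin 1) (Fin 0) ℝ) (fun _ => -1) = ∅ := by
    ext y
    simp only [polyhedron, Set.mem_ofPred_eq, Set.mem_empty_iff_false, iff_false]
    intro hy
    have := hy 0
    simp at this
    linarith
  exact ⟨0, 0, fun _ => -1, 0, by simp [h], by simp [h]⟩

/-- The projection of a bounded section of the nonnegative orthant by an affine subspace needs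
essentially one inequality for each coordinate. -/
theorem exists_hasExtendedFormulation_of_orthant_section {ι : Type*} [Fintype ι] {d : ℕ}
    (S : AffineSubspace ℝ (ι → ℝ)) (f : (ι → ℝ) →ₗ[ℝ] (Fin d → ℝ))
    (hb : Bornology.IsBounded {x | x ∈ S ∧ 0 ≤ x}) :
    ∃ r ≤ Fintype.card ι + 1, HasExtendedFormulation (f '' {x | x ∈ S ∧ 0 ≤ x}) r := by
  classical
  rcases (S : Set (ι → ℝ)).eq_empty_or_nonempty with hS | ⟨p, hp⟩
  -- An empty subspace has no base point to parametrise from. A single infeasible inequality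
  -- describes it; this is the source of the `+ 1`.
  · refine ⟨1, by omega, ?_⟩
    have : {x | x ∈ S ∧ 0 ≤ x} = ∅ := by
      ext x
      have : x ∉ (S : Set (ι → ℝ)) := by simp [hS]
      simp only [SetLike.mem_coe] at this
      simp [this]
    rw [this, Set.image_empty]
    exact hasExtendedFormulation_empty
  refine ⟨Fintype.card ι, by omega, Module.finrank ℝ S.direction, ?_⟩
  let E := (Module.finBasis ℝ S.direction).equivFun
  let B : (Fin (Module.finrank ℝ S.direction) → ℝ) →ₗ[ℝ] (ι → ℝ) :=
    S.direction.subtype ∘ₗ E.symm.toLinearMap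
  have hBinj : LinearMap.ker B = ⊥ := by
    rw [LinearMap.ker_eq_bot]
    exact Subtype.val_injective.comp E.symm.injective
  obtain ⟨C, hC⟩ := B.exists_leftInverse_of_injective hBinj
  let e := Fintype.equivFin ι
  let A : Matrix (Fin (Fintype.card ι)) (Fin (Module.finrank ℝ S.direction)) ℝ :=
    (-LinearMap.toMatrix' B).submatrix e.symm id
  let g : (Fin (Module.finrank ℝ S.direction) → ℝ) →ᵃ[ℝ] (ι → ℝ) :=
    B.toAffineMap + AffineMap.const ℝ _ p
  have hg : ∀ y, g y = B y + p := fun y => rfl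
  have hpoly : ∀ y, y ∈ polyhedron A (p ∘ e.symm) ↔ 0 ≤ g y := by
    intro y
    have hA : ∀ i, (A *ᵥ y) i = -(B y (e.symm i)) := by
      intro i
      have := congrFun (LinearMap.toMatrix'_mulVec B y) (e.symm i)
      rw [← this]
      simp [A, Matrix.mulVec, dotProduct]
    simp only [polyhedron, Set.mem_ofPred_eq, hg, Pi.le_def, hA, Function.comp, Pi.add_apply,
      Pi.zero_apply]
    rw [← e.symm.forall_congr_right (q := fun i => 0 ≤ B y i + p i)]
    exact forall_congr' fun i => by constructor <;> intro h <;> linarith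
  have hgS : ∀ y, g y ∈ S := fun y =>
    AffineSubspace.vadd_mem_of_mem_direction (E.symm y).2 hp
  have hsurj : ∀ x ∈ S, ∃ y, g y = x := by
    intro x hx
    refine ⟨E ⟨x - p, AffineSubspace.vsub_mem_direction hx hp⟩, ?_⟩
    simp [hg, B]
  have himage : g '' polyhedron A (p ∘ e.symm) = {x | x ∈ S ∧ 0 ≤ x} := by
    ext x
    constructor
    · rintro ⟨y, hy, rfl⟩
      exact ⟨hgS y, (hpoly y).1 hy⟩
    · rintro ⟨hx, h0⟩
      obtain ⟨y, rfl⟩ := hsurj x hx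
      exact ⟨y, (hpoly y).2 h0, rfl⟩
  refine ⟨A, p ∘ e.symm, f.toAffineMap.comp g, ?_, ?_⟩
  -- Boundedness pulls back along the parametrisation because `y = C (g y - p)`.
  · refine ((LinearMap.toContinuousLinearMap C).lipschitz.isBounded_image
      ((LipschitzWith.id.sub (LipschitzWith.const p)).isBounded_image hb)).subset ?_
    intro y hy
    refine ⟨_, ⟨g y, himage ▸ ⟨y, hy, rfl⟩, rfl⟩, ?_⟩
    simpa [hg] using LinearMap.congr_fun hC y
  · rw [← himage, Set.image_image]
    rfl

/-! ## Unit flows in layered graphs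

The vertices of each layer are the elements of `V`, and an element `e = (u, b, v)` of `E` gives in
each layer an arc from `u` to `v` that is labelled with the bit `b`. -/

section LayeredFlow

variable {V : Type}

/-- The words `b` that label the paths with `k` arcs from `v₀` to `v`. -/
def pathWords (E : Finset (V × Bool × V)) (v₀ : V) (k : ℕ) (v : V) : Set (ℕ → Bool) :=
  {b | ∃ p : ℕ → V, p 0 = v₀ ∧ p k = v ∧ ∀ i < k, (p i, b i, p (i + 1)) ∈ E}

theorem pathWords_succ {E : Finset (V × Bool × V)} {v₀ : V} {k : ℕ} {b : ℕ → Bool} {e : V × Bool × V} (he : e ∈ E)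
    (hb : b ∈ pathWords E v₀ k e.1) :
    Function.update b k e.2.1 ∈ pathWords E v₀ (k + 1) e.2.2 := by
  obtain ⟨p, h0, hk, hp⟩ := hb
  refine ⟨Function.update p (k + 1) e.2.2, by simp [h0], by simp, fun i hi => ?_⟩
  rcases Nat.lt_succ_iff_lt_or_eq.1 hi with h | rfl
  · rw [Function.update_of_ne (by omega), Function.update_of_ne (by omega),
      Function.update_of_ne (by omega)]
    exact hp i h
  · rw [Function.update_of_ne (by omega), hk]
    simpa using he

variable [DecidableEq V] (E : Finset (V × Bool × V)) (v₀ : V)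

/-- The amount of flow entering each vertex of the `k`-th layer; one unit enters the graph at
`v₀`. -/
def inflow (x : ℕ → E → ℝ) : ℕ → V → ℝ
  | 0, v => if v = v₀ then 1 else 0
  | k + 1, v => ∑ e : E with e.1.2.2 = v, x k e

/-- `x` is conserved in the first `n` layers. -/
def FlowConserved (n : ℕ) (x : ℕ → E → ℝ) : Prop :=
  ∀ k < n, ∀ v, ∑ e : E with e.1.1 = v, x k e = inflow E v₀ x k v

variable {E v₀}

theorem inflow_nonneg {n : ℕ} {x : ℕ → E → ℝ} (hx : ∀ k < n, ∀ e, 0 ≤ x k e) :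
    ∀ k ≤ n, ∀ v, 0 ≤ inflow E v₀ x k v
  | 0, _, v => by simp only [inflow]; split_ifs <;> norm_num
  | k + 1, hk, v => Finset.sum_nonneg fun e _ => hx k (by omega) e

/-- The flow that is given by its values in the first `n` layers. -/
def extendFlow {n : ℕ} (x : Fin n × E → ℝ) (k : ℕ) (e : E) : ℝ :=
  if h : k < n then x (⟨k, h⟩, e) else 0

/-- The flows through the first `n` layers that end in `F`. -/
def flowSubspace (E : Finset (V × Bool × V)) (v₀ : V) (F : Set V) (n : ℕ) :
    AffineSubspace ℝ (Fin n × E → ℝ) where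
  carrier := {x | FlowConserved E v₀ n (extendFlow x) ∧
    ∀ v ∉ F, inflow E v₀ (extendFlow x) n v = 0}
  smul_vsub_vadd_mem' := by
    rintro c x₁ x₂ x₃ ⟨h₁, h₁'⟩ ⟨h₂, h₂'⟩ ⟨h₃, h₃'⟩
    have hext : ∀ k e, extendFlow (c • (x₁ -ᵥ x₂) +ᵥ x₃) k e =
        c * (extendFlow x₁ k e - extendFlow x₂ k e) + extendFlow x₃ k e := by
      intro k e
      unfold extendFlow
      split_ifs <;> simp
    have hin : ∀ k v, inflow E v₀ (extendFlow (c • (x₁ -ᵥ x₂) +ᵥ x₃)) k v =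
        c * (inflow E v₀ (extendFlow x₁) k v - inflow E v₀ (extendFlow x₂) k v) +
          inflow E v₀ (extendFlow x₃) k v := by
      rintro (_ | k) v
      · simp [inflow]
      · simp only [inflow, hext, Finset.sum_add_distrib, Finset.sum_sub_distrib, ← Finset.mul_sum]
    refine ⟨fun k hk v => ?_, fun v hv => ?_⟩
    · rw [hin, ← h₁ k hk v, ← h₂ k hk v, ← h₃ k hk v]
      simp only [hext, Finset.sum_add_distrib, Finset.sum_sub_distrib, ← Finset.mul_sum]
    · rw [hin, h₁' v hv, h₂' v hv, h₃' v hv]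
      simp

/-- The bits read by a flow. -/
def flowBits (E : Finset (V × Bool × V)) (n : ℕ) : (Fin n × E → ℝ) →ₗ[ℝ] (Fin n → ℝ) where
  toFun x i := ∑ e : E, x (i, e) * (if e.1.2.1 then 1 else 0)
  map_add' x y := by
    ext i
    simp only [Pi.add_apply, add_mul, Finset.sum_add_distrib]
  map_smul' c x := by
    ext i
    simp only [Pi.smul_apply, smul_eq_mul, mul_assoc, Finset.mul_sum, RingHom.id_apply]

/-- The words of length `n` that label a path from `v₀` to `F`. -/
def acceptedWords (E : Finset (V × Bool × V)) (v₀ : V) (F : Set V) (n : ℕ) :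
    Set (Fin n → Bool) :=
  {x | ∃ p : ℕ → V, p 0 = v₀ ∧ p n ∈ F ∧ ∀ i : Fin n, (p i, x i, p (i + 1)) ∈ E}

theorem bitVector_mem_image_flowBits {F : Set V} {n : ℕ} {x : Fin n → Bool}
    (hx : x ∈ acceptedWords E v₀ F n) :
    bitVector x ∈ flowBits E n '' {y | y ∈ flowSubspace E v₀ F n ∧ 0 ≤ y} := by
  obtain ⟨p, h0, hn, hp⟩ := hx
  let a : Fin n → E := fun i => ⟨_, hp i⟩
  let y : Fin n × E → ℝ := fun z => if z.2 = a z.1 then 1 else 0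
  have hsum : ∀ (k : ℕ) (hk : k < n) (q : E → Prop) [DecidablePred q],
      ∑ e : E with q e, extendFlow y k e = if q (a ⟨k, hk⟩) then 1 else 0 := by
    intro k hk q _
    simp [extendFlow, hk, y, Finset.sum_ite_eq']
  have hin : ∀ k ≤ n, ∀ v, inflow E v₀ (extendFlow y) k v = if p k = v then 1 else 0 := by
    rintro (_ | k) hk v
    · simp [inflow, h0, eq_comm]
    · simp only [inflow]
      rw [hsum k hk]
  refine ⟨y, ⟨⟨fun k hk v => ?_, fun v hv => ?_⟩, fun z => ?_⟩, ?_⟩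
  · rw [hsum k hk, hin k hk.le]
  · rw [hin n le_rfl, if_neg]
    rintro rfl
    exact hv hn
  · simp only [y]
    split_ifs <;> simp
  · ext i
    change ∑ e : E, (if e = a i then (1 : ℝ) else 0) * (if e.1.2.1 then 1 else 0) = _
    simp_rw [ite_mul, one_mul, zero_mul]
    rw [Finset.sum_ite_eq' Finset.univ (a i)]
    simp [bitVector, a]

/-! ### Decomposition of flows into paths -/

variable [Fintype V]

/-- Grouping the arcs of a layer by head or by tail gives the same total, and conservation equates
the latter with the inflow of that layer. -/
theorem sum_inflow {n : ℕ} {x : ℕ → E → ℝ} (hc : FlowConserved E v₀ n x) :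
    ∀ k ≤ n, ∑ v, inflow E v₀ x k v = 1
  | 0, _ => by simp [inflow]
  | k + 1, hk => by
    rw [← sum_inflow hc k (by omega), ← Finset.sum_congr rfl fun v _ => hc k (by omega) v]
    simp only [inflow]
    rw [Finset.sum_fiberwise, Finset.sum_fiberwise]

theorem flow_le_one {n : ℕ} {x : ℕ → E → ℝ} (hx : ∀ k < n, ∀ e, 0 ≤ x k e)
    (hc : FlowConserved E v₀ n x) {k : ℕ} (hk : k < n) (e : E) : x k e ≤ 1 := by
  rw [← sum_inflow hc (k + 1) hk]
  simp only [inflow]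
  rw [Finset.sum_fiberwise]
  exact Finset.single_le_sum (fun e _ => hx k hk e) (Finset.mem_univ e)

variable {W : Type*} [AddCommGroup W] [Module ℝ W] (ω : ℕ → Bool → W)

/-- Points of weight zero may be arbitrary, which allows junk values at vertices without inflow. -/
theorem sum_smul_mem_convexHull_of_ne_zero {ι : Type*} [Fintype ι] {s : Set W} {w : ι → ℝ}
    {z : ι → W} (h0 : ∀ i, 0 ≤ w i) (h1 : ∑ i, w i = 1)
    (hz : ∀ i, w i ≠ 0 → z i ∈ convexHull ℝ s) : ∑ i, w i • z i ∈ convexHull ℝ s := by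
  have := (convex_convexHull ℝ s).finsum_mem h0 (by rwa [finsum_eq_sum_of_fintype]) hz
  rwa [finsum_eq_sum_of_fintype] at this

/-- A flow is a combination of paths: its part that enters a vertex of the `k`-th layer is a
multiple of a convex combination of path vectors. -/
theorem exists_mem_convexHull_pathWords {n : ℕ} {x : ℕ → E → ℝ} (hx : ∀ k < n, ∀ e, 0 ≤ x k e)
    (hc : FlowConserved E v₀ n x) (k : ℕ) (hk : k ≤ n) :
    ∃ p : V → W,
      (∀ v, inflow E v₀ x k v ≠ 0 →
        p v ∈ convexHull ℝ ((fun b => ∑ i ∈ Finset.range k, ω i (b i)) '' pathWords E v₀ k v)) ∧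
      ∑ v, inflow E v₀ x k v • p v =
        ∑ i ∈ Finset.range k, ∑ e : E, x i e • ω i e.1.2.1 := by
  induction k with
  | zero =>
    refine ⟨0, fun v hv => subset_convexHull ℝ _ ?_, by simp⟩
    have hv : v = v₀ := by
      by_contra h
      simp [inflow, h] at hv
    exact ⟨fun _ => false, ⟨fun _ => v₀, rfl, hv.symm, by simp⟩, by simp⟩
  | succ k ih =>
    obtain ⟨p, hp, hsum⟩ := ih (by omega)
    have hx' := hx k (by omega)
    have hzero : ∀ v, inflow E v₀ x (k + 1) v = 0 → ∀ e : E, e.1.2.2 = v → x k e = 0 := by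
      intro v hv e he
      exact (Finset.sum_eq_zero_iff_of_nonneg fun e _ => hx' e).1 hv e (by simp [he])
    -- An arc carrying flow leaves a vertex with nonzero inflow, so the induction hypothesis applies
    -- at its tail; translating by `ω k` of its label extends the paths there by this arc.
    have hq : ∀ e : E, x k e ≠ 0 → p e.1.1 + ω k e.1.2.1 ∈ convexHull ℝ
        ((fun b => ∑ i ∈ Finset.range (k + 1), ω i (b i)) ''
          pathWords E v₀ (k + 1) e.1.2.2) := by
      intro e he
      have hne : inflow E v₀ x k e.1.1 ≠ 0 := by
        rw [← hc k (by omega)]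
        intro h
        exact he ((Finset.sum_eq_zero_iff_of_nonneg fun e _ => hx' e).1 h e (by simp))
      have h : p e.1.1 + ω k e.1.2.1 ∈ convexHull ℝ ((AffineEquiv.constVAdd ℝ W (ω k e.1.2.1)) ''
          ((fun b => ∑ i ∈ Finset.range k, ω i (b i)) '' pathWords E v₀ k e.1.1)) := by
        rw [← AffineEquiv.coe_toAffineMap, ← AffineMap.image_convexHull]
        exact ⟨_, hp _ hne, by simp [add_comm]⟩
      refine convexHull_mono ?_ h
      rintro _ ⟨_, ⟨b, hb, rfl⟩, rfl⟩
      refine ⟨_, pathWords_succ e.2 hb, ?_⟩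
      simp only [Finset.sum_range_succ, Function.update_self,
        AffineEquiv.constVAdd_apply, vadd_eq_add]
      rw [add_comm]
      congr 1
      refine Finset.sum_congr rfl fun i hi => ?_
      rw [Function.update_of_ne (Finset.mem_range.1 hi).ne]
    -- The point at `v` averages over the arcs entering `v`, each weighted by its share of the
    -- inflow.
    refine ⟨fun v => ∑ e : E, (if e.1.2.2 = v then x k e / inflow E v₀ x (k + 1) v else 0) •
      (p e.1.1 + ω k e.1.2.1), fun v hv => ?_, ?_⟩
    · refine sum_smul_mem_convexHull_of_ne_zero (fun e => ?_) ?_ fun e he => ?_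
      · split_ifs
        · exact div_nonneg (hx' e) (inflow_nonneg hx _ hk v)
        · exact le_rfl
      · rw [← Finset.sum_filter, ← Finset.sum_div]
        exact div_self hv
      · have he' : e.1.2.2 = v := by
          by_contra h
          simp [h] at he
        subst he'
        exact hq e fun h => he (by simp [h])
    · rw [Finset.sum_range_succ, ← hsum]
      simp only [Finset.smul_sum, smul_smul]
      rw [Finset.sum_comm]
      have h1 : ∀ e : E, ∑ v, (inflow E v₀ x (k + 1) v *
          (if e.1.2.2 = v then x k e / inflow E v₀ x (k + 1) v else 0)) •
          (p e.1.1 + ω k e.1.2.1) = x k e • p e.1.1 + x k e • ω k e.1.2.1 := by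
        intro e
        rw [← Finset.sum_smul, ← smul_add]
        congr 1
        simp only [mul_ite, mul_zero, Finset.sum_ite_eq, Finset.mem_univ, if_true]
        by_cases h : inflow E v₀ x (k + 1) e.1.2.2 = 0
        · rw [hzero _ h e rfl]; simp
        · field_simp
      rw [Finset.sum_congr rfl fun e _ => h1 e, Finset.sum_add_distrib]
      congr 1
      -- Regrouped by tail, the outflow of each vertex is its inflow by conservation.
      rw [← Finset.sum_fiberwise (s := Finset.univ) (g := fun e : E => e.1.1)]
      refine Finset.sum_congr rfl fun v _ => ?_
      rw [← hc k (by omega) v, Finset.sum_smul]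
      refine Finset.sum_congr rfl fun e he => ?_
      rw [(Finset.mem_filter.1 he).2]

theorem flowBits_mem_convexHull {F : Set V} {n : ℕ} {x : Fin n × E → ℝ}
    (hx : x ∈ flowSubspace E v₀ F n) (h0 : 0 ≤ x) :
    flowBits E n x ∈ convexHull ℝ (bitVector '' acceptedWords E v₀ F n) := by
  have hnn : ∀ k < n, ∀ e, 0 ≤ extendFlow x k e := by
    intro k hk e
    simpa [extendFlow, hk] using h0 (⟨k, hk⟩, e)
  -- Reading `b` in layer `k` contributes `b` at coordinate `k`, so the sum along a path is its bit
  -- vector.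
  let ω : ℕ → Bool → Fin n → ℝ := fun k b j => if (j : ℕ) = k ∧ b then 1 else 0
  obtain ⟨p, hp, hsum⟩ := exists_mem_convexHull_pathWords ω hnn hx.1 n le_rfl
  have hval : flowBits E n x = ∑ v, inflow E v₀ (extendFlow x) n v • p v := by
    rw [hsum]
    ext j
    simp only [Finset.sum_apply, Pi.smul_apply, smul_eq_mul]
    rw [Finset.sum_eq_single (j : ℕ)]
    · simp [flowBits, extendFlow, ω]
    · intro i _ hij
      simp [ω, hij.symm]
    · simp
  rw [hval]
  refine sum_smul_mem_convexHull_of_ne_zero (inflow_nonneg hnn n le_rfl)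
    (sum_inflow hx.1 n le_rfl) fun v hv => convexHull_mono ?_ (hp v hv)
  rintro _ ⟨b, ⟨q, hq0, hqn, hq⟩, rfl⟩
  have hvF : v ∈ F := by
    by_contra h
    exact hv (hx.2 v h)
  refine ⟨fun i => b i, ⟨q, hq0, hqn ▸ hvF, fun i => hq i i.2⟩, ?_⟩
  ext j
  simp only [Finset.sum_apply]
  rw [Finset.sum_eq_single (j : ℕ)]
  · simp [ω, bitVector]
  · intro i _ hij
    simp [ω, hij.symm]
  · simp

theorem exists_hasExtendedFormulation_acceptedWords (E : Finset (V × Bool × V)) (v₀ : V)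
    (F : Set V) (n : ℕ) :
    ∃ r ≤ n * E.card + 1,
      HasExtendedFormulation (convexHull ℝ (bitVector '' acceptedWords E v₀ F n)) r := by
  have himage : flowBits E n '' {x | x ∈ flowSubspace E v₀ F n ∧ 0 ≤ x} =
      convexHull ℝ (bitVector '' acceptedWords E v₀ F n) := by
    apply Set.Subset.antisymm
    · rintro _ ⟨x, ⟨hx, h0⟩, rfl⟩
      exact flowBits_mem_convexHull hx h0
    · refine convexHull_min ?_ (Convex.linear_image ?_ _)
      · rintro _ ⟨x, hx, rfl⟩
        exact bitVector_mem_image_flowBits hx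
      · exact (flowSubspace E v₀ F n).convex.inter (convex_Ici (𝕜 := ℝ) _)
  have hb : Bornology.IsBounded {x | x ∈ flowSubspace E v₀ F n ∧ 0 ≤ x} := by
    refine (Metric.isBounded_Icc (0 : Fin n × E → ℝ) 1).subset ?_
    rintro x ⟨hx, h0⟩
    refine ⟨h0, fun z => ?_⟩
    have := flow_le_one (fun k hk e => ?_) hx.1 z.1.2 z.2
    · simpa [extendFlow] using this
    · simpa [extendFlow, hk] using h0 (⟨k, hk⟩, e)
  have := exists_hasExtendedFormulation_of_orthant_section (flowSubspace E v₀ F n)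
    (flowBits E n) hb
  rw [himage] at this
  simpa using this

end LayeredFlow

/-! ## Space-bounded one-pass machines as finite automata -/

namespace OnlineTM

/-- A configuration without the input: the state, the work tape and the position of its head. -/
structure WorkConfig (M : OnlineTM) where
  state : M.State
  tape : ℕ → Bool
  head : ℕ

variable {M : OnlineTM}

/-- The part of a configuration that does not mention the input. -/
def Config.work (c : M.Config) : M.WorkConfig where
  state := c.state
  tape := c.tape
  head := c.head

namespace WorkConfig

/-- The configuration with the remaining input `y`. -/
def withInput (w : M.WorkConfig) (y : List Bool) : M.Config where
  state := w.state
  input := y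
  tape := w.tape
  head := w.head

/-- The effect of an action. -/
def next (w : M.WorkConfig) (a : TMAction M.State) : M.WorkConfig where
  state := a.state
  tape := Function.update w.tape w.head a.write
  head := a.workMove.apply w.head

/-- One step in which the scanned input symbol is `o` and the input head makes the move `m`. -/
def Step (o : Option Bool) (m : InputMove) (w w' : M.WorkConfig) : Prop :=
  ∃ a ∈ M.trans w.state o (w.tape w.head), a.inputMove = m ∧ w.next a = w'

/-- No action is available when the scanned input symbol is `o`, and the state accepts. -/
def AcceptingHalt (o : Option Bool) (w : M.WorkConfig) : Prop :=
  M.trans w.state o (w.tape w.head) = ∅ ∧ w.state ∈ M.accepting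

/-- A computation that does not move the input head away from the symbol `o`. -/
def Stays (o : Option Bool) : M.WorkConfig → M.WorkConfig → Prop :=
  Relation.ReflTransGen (Step o .stay)

/-- The transitions on an input bit of the automaton simulating `M`; `none` is its state after `M`
has halted and accepted. -/
def BitStep (b : Bool) : Option M.WorkConfig → Option M.WorkConfig → Prop
  | some w, some w' => ∃ u, Stays (some b) w u ∧ Step (some b) .right u w'
  | some w, none => ∃ u, Stays (some b) w u ∧ AcceptingHalt (some b) u
  | none, none => True
  | none, some _ => False

/-- Acceptance at the end of the input. -/
def AcceptsAtEnd : Option M.WorkConfig → Prop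
  | some w => ∃ u, Relation.ReflTransGen (fun v v' => ∃ m, Step none m v v') w u ∧
      AcceptingHalt none u
  | none => True

/-- Acceptance of the remaining input `y` by the automaton simulating `M`. -/
def AutomatonAccepts : Option M.WorkConfig → List Bool → Prop
  | w, [] => AcceptsAtEnd w
  | w, b :: y => ∃ w', BitStep b w w' ∧ AutomatonAccepts w' y

/-! ### Equivalence of the machine and its automaton -/

theorem step_withInput_of_step {o : Option Bool} {m : InputMove} {w w' : M.WorkConfig}
    (h : Step o m w w') {y : List Bool} (hy : y.head? = o) :
    M.Step (w.withInput y) (w'.withInput (m.apply y)) := by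
  obtain ⟨a, ha, rfl, rfl⟩ := h
  subst hy
  exact ⟨a, ha, rfl⟩

theorem exists_step_of_step {c c' : M.Config} (h : M.Step c c') :
    ∃ m, Step c.input.head? m c.work c'.work ∧ c'.input = m.apply c.input := by
  obtain ⟨a, ha, rfl⟩ := h
  exact ⟨a.inputMove, ⟨a, ha, rfl, rfl⟩, rfl⟩

theorem reflTransGen_withInput_of_stays {b : Bool} {w u : M.WorkConfig}
    (h : Stays (some b) w u) (y : List Bool) :
    Relation.ReflTransGen M.Step (w.withInput (b :: y)) (u.withInput (b :: y)) :=
  Relation.ReflTransGen.lift (r := Step (some b) .stay) (fun v => withInput v (b :: y))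
    (fun _ _ h => step_withInput_of_step h rfl) _ _ h

theorem exists_halted_of_automatonAccepts : ∀ (y : List Bool) (w : M.WorkConfig),
    AutomatonAccepts (some w) y →
      ∃ c, Relation.ReflTransGen M.Step (w.withInput y) c ∧ M.Halted c ∧ c.state ∈ M.accepting
  | [], w, ⟨u, hu, hh, hacc⟩ =>
    ⟨u.withInput [], Relation.ReflTransGen.lift (fun v => v.withInput [])
      (fun _ _ ⟨m, h⟩ => by
        have := step_withInput_of_step h (y := []) rfl
        cases m <;> exact this) _ _ hu, hh, hacc⟩
  -- The machine may halt with input left unread, so the rest of the word is irrelevant.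
  | b :: y, w, ⟨none, ⟨u, hu, hh, hacc⟩, _⟩ =>
    ⟨u.withInput (b :: y), reflTransGen_withInput_of_stays hu y, hh, hacc⟩
  | b :: y, w, ⟨some w', ⟨u, hu, hs⟩, h⟩ => by
    obtain ⟨c, hc, hh⟩ := exists_halted_of_automatonAccepts y w' h
    exact ⟨c, (reflTransGen_withInput_of_stays hu y).trans
      (.head (step_withInput_of_step hs rfl) hc), hh⟩

/-- The work configurations that fit into the first `s` cells. -/
def Fits (s : ℕ) : Set M.WorkConfig :=
  {w | w.head < s ∧ ∀ i, s ≤ i → w.tape i = false}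

theorem work_mem_fits {s : ℕ} {x : List Bool} (hs : ∀ c, M.Reaches x c → c.head < s)
    {c : M.Config} (h : M.Reaches x c) : c.work ∈ Fits s := by
  refine ⟨hs c h, ?_⟩
  induction h with
  | refl => exact fun _ _ => rfl
  | @tail c c' hc hstep ih =>
    obtain ⟨a, _, rfl⟩ := hstep
    intro i hi
    have := hs c hc
    change Function.update c.tape c.head a.write i = false
    rw [Function.update_of_ne (by omega)]
    exact ih i hi

/-- The states of the automaton that simulates `M` in space `s`. -/
abbrev BoundedState (M : OnlineTM) (s : ℕ) : Type :=
  Option (Fits (M := M) s)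

/-- The underlying state of the unbounded automaton. -/
def BoundedState.toOption {s : ℕ} (v : BoundedState M s) : Option M.WorkConfig :=
  v.map Subtype.val

/-- Acceptance of `y` by the automaton that simulates `M` in space `s`. -/
def BoundedAccepts {s : ℕ} : BoundedState M s → List Bool → Prop
  | v, [] => AcceptsAtEnd v.toOption
  | v, b :: y => ∃ v' : BoundedState M s, BitStep b v.toOption v'.toOption ∧ BoundedAccepts v' y

theorem boundedAccepts_none {s : ℕ} : ∀ y : List Bool,
    BoundedAccepts (none : BoundedState M s) y
  | [] => trivial
  | _ :: y => ⟨none, trivial, boundedAccepts_none y⟩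

theorem automatonAccepts_of_boundedAccepts {s : ℕ} : ∀ (y : List Bool) (v : BoundedState M s),
    BoundedAccepts v y → AutomatonAccepts v.toOption y
  | [], _, h => h
  | _ :: y, _, ⟨v', hs, h⟩ => ⟨v'.toOption, hs, automatonAccepts_of_boundedAccepts y v' h⟩

/-- Backward induction along the accepting computation: a stay step on a bit is absorbed into the
first transition, a right step opens a new one. Reachability is carried along to ensure that the
configurations fit into `s` cells. -/
theorem boundedAccepts_of_reaches {s : ℕ} {x : List Bool}
    (hs : ∀ c, M.Reaches x c → c.head < s) {c c' : M.Config}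
    (h : Relation.ReflTransGen M.Step c c') (hh : M.Halted c') (hacc : c'.state ∈ M.accepting) :
    M.Reaches x c → ∀ v : Fits (M := M) s, v.1 = c.work →
      BoundedAccepts (some v : BoundedState M s) c.input := by
  induction h using Relation.ReflTransGen.head_induction_on with
  | refl =>
    rintro - ⟨_, hv⟩ rfl
    obtain ⟨q, y, t, i⟩ := c'
    cases y with
    | nil => exact ⟨_, .refl, hh, hacc⟩
    | cons b y => exact ⟨none, ⟨_, .refl, hh, hacc⟩, boundedAccepts_none y⟩
  | @head c c₁ hstep _ ih =>
    rintro hr ⟨_, hv⟩ rfl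
    have hr₁ : M.Reaches x c₁ := hr.tail hstep
    have ih := ih hr₁ ⟨_, work_mem_fits hs hr₁⟩ rfl
    obtain ⟨m, hm, hin⟩ := exists_step_of_step hstep
    obtain ⟨q, y, t, i⟩ := c
    dsimp only at hin hm ⊢
    rw [hin] at ih
    cases y with
    | nil =>
      -- Past the end of the input both head moves have the same effect, so every step joins the
      -- final phase.
      have hnil : m.apply ([] : List Bool) = [] := by cases m <;> rfl
      rw [hnil] at ih
      obtain ⟨u, hu, hu'⟩ := ih
      exact ⟨u, .head ⟨m, hm⟩ hu, hu'⟩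
    | cons b y =>
      cases m with
      | stay =>
        obtain ⟨v', hv', hy⟩ := ih
        refine ⟨v', ?_, hy⟩
        cases v' with
        | none =>
          obtain ⟨u, hu, hu'⟩ := hv'
          exact ⟨u, .head hm hu, hu'⟩
        | some v' =>
          obtain ⟨u, hu, hu'⟩ := hv'
          exact ⟨u, .head hm hu, hu'⟩
      | right => exact ⟨some ⟨_, work_mem_fits hs hr₁⟩, ⟨_, .refl, hm⟩, ih⟩

/-- The space bound matters only from left to right; conversely a bounded run is also a run of the
unbounded automaton, which the machine can imitate. -/
theorem accepts_iff_boundedAccepts {s : ℕ} {x : List Bool}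
    (hs : ∀ c, M.Reaches x c → c.head < s) (v : Fits (M := M) s) (hv : v.1 = (M.init x).work) :
    M.Accepts x ↔ BoundedAccepts (some v : BoundedState M s) x := by
  constructor
  · rintro ⟨c, hc, hh, hacc⟩
    exact boundedAccepts_of_reaches hs hc hh hacc .refl v hv
  · intro h
    have h := exists_halted_of_automatonAccepts _ _ (automatonAccepts_of_boundedAccepts _ _ h)
    rw [hv] at h
    exact h

theorem boundedAccepts_ofFn_iff {s : ℕ} : ∀ {n : ℕ} (x : Fin n → Bool) (v : BoundedState M s),
    BoundedAccepts v (List.ofFn x) ↔ ∃ p : ℕ → BoundedState M s, p 0 = v ∧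
      AcceptsAtEnd (p n).toOption ∧
      ∀ i : Fin n, BitStep (x i) (p i).toOption (p (i + 1)).toOption
  | 0, x, v => by
    simp only [List.ofFn_zero, BoundedAccepts]
    constructor
    · exact fun h => ⟨fun _ => v, rfl, h, fun i => i.elim0⟩
    · rintro ⟨p, rfl, h, -⟩
      exact h
  | n + 1, x, v => by
    simp only [List.ofFn_succ, BoundedAccepts]
    constructor
    · rintro ⟨v', hs, h⟩
      obtain ⟨p, rfl, hn, hp⟩ := (boundedAccepts_ofFn_iff _ v').1 h
      refine ⟨fun k => Nat.casesOn k v p, rfl, hn, fun i => ?_⟩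
      induction i using Fin.cases with
      | zero => exact hs
      | succ i => exact hp i
    · rintro ⟨p, rfl, hn, hp⟩
      exact ⟨p 1, hp 0, (boundedAccepts_ofFn_iff _ _).2
        ⟨fun k => p (k + 1), rfl, hn, fun i => hp i.succ⟩⟩

/-! ### Counting -/

theorem exists_injective_fits (M : OnlineTM) (s : ℕ) :
    ∃ f : Fits (M := M) s → M.State × (Fin s → Bool) × Fin s, Function.Injective f := by
  refine ⟨fun w => (w.1.state, (fun i => w.1.tape i), ⟨w.1.head, w.2.1⟩), ?_⟩
  rintro ⟨⟨q, t, i⟩, hi, ht⟩ ⟨⟨q', t', i'⟩, hi', ht'⟩ h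
  simp only [Prod.mk.injEq, Fin.mk.injEq] at h
  obtain ⟨rfl, htt, rfl⟩ := h
  obtain rfl : t = t' := by
    funext j
    by_cases hj : j < s
    · exact congrFun htt ⟨j, hj⟩
    · exact (ht j (not_lt.1 hj)).trans (ht' j (not_lt.1 hj)).symm
  rfl

instance (s : ℕ) : Finite (Fits (M := M) s) := by
  have := M.finite_state
  obtain ⟨f, hf⟩ := exists_injective_fits M s
  exact Finite.of_injective f hf

theorem card_fits_le (M : OnlineTM) (s : ℕ) :
    Nat.card (Fits (M := M) s) ≤ Nat.card M.State * (2 ^ s * s) := by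
  have := M.finite_state
  obtain ⟨f, hf⟩ := exists_injective_fits M s
  simpa using Nat.card_le_card_of_injective f hf

/-! ### Determinism -/

theorem step_unique (hM : M.Deterministic) {o : Option Bool} {m m' : InputMove}
    {w u u' : M.WorkConfig} (h : Step o m w u) (h' : Step o m' w u') : m = m' ∧ u = u' := by
  obtain ⟨a, ha, rfl, rfl⟩ := h
  obtain ⟨a', ha', rfl, rfl⟩ := h'
  obtain rfl := hM _ _ _ ha ha'
  exact ⟨rfl, rfl⟩

/-- Deterministic stay computations from `w` form a chain, and two elements of it that cannot be
prolonged coincide. -/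
theorem stays_unique (hM : M.Deterministic) {o : Option Bool} {w u u' : M.WorkConfig}
    (h : Stays o w u) (h' : Stays o w u') (hu : ∀ z, ¬ Step o .stay u z)
    (hu' : ∀ z, ¬ Step o .stay u' z) : u = u' := by
  have aux : ∀ {a b : M.WorkConfig}, (∀ z, ¬ Step o .stay a z) → Stays o a b → a = b := by
    intro a b ha hab
    rcases Relation.ReflTransGen.cases_head hab with h | ⟨z, hz, -⟩
    · exact h
    · exact (ha z hz).elim
  rcases Relation.ReflTransGen.total_of_right_unique
    (r := Step (M := M) o .stay) (fun _ _ _ h₁ h₂ => (step_unique hM h₁ h₂).2) h h' with h | h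
  · exact aux hu h
  · exact (aux hu' h).symm

theorem not_stay_of_right (hM : M.Deterministic) {o : Option Bool} {u w : M.WorkConfig}
    (h : Step o .right u w) (z : M.WorkConfig) : ¬ Step o .stay u z :=
  fun hz => by cases (step_unique hM h hz).1

theorem not_step_of_acceptingHalt {o : Option Bool} {m : InputMove} {u : M.WorkConfig}
    (h : AcceptingHalt o u) (z : M.WorkConfig) : ¬ Step o m u z := by
  rintro ⟨a, ha, -⟩
  rw [h.1] at ha
  exact ha

/-- A right move and an accepting halt both exclude a further stay step, so the configuration where
the bit is left or the machine halts is unique; there the two outcomes exclude each other. -/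
theorem bitStep_unique (hM : M.Deterministic) {b : Bool} :
    ∀ {v v₁ v₂ : Option M.WorkConfig}, BitStep b v v₁ → BitStep b v v₂ → v₁ = v₂
  | none, none, none, _, _ => rfl
  | none, some _, _, h, _ => h.elim
  | none, _, some _, _, h => h.elim
  | some _, none, none, _, _ => rfl
  | some _, some w₁, some w₂, ⟨u₁, h₁, h₁'⟩, ⟨u₂, h₂, h₂'⟩ => by
    obtain rfl := stays_unique hM h₁ h₂ (not_stay_of_right hM h₁') (not_stay_of_right hM h₂')
    rw [(step_unique hM h₁' h₂').2]
  | some _, some w₁, none, ⟨u₁, h₁, h₁'⟩, ⟨u₂, h₂, h₂'⟩ => by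
    obtain rfl := stays_unique hM h₁ h₂ (not_stay_of_right hM h₁') (not_step_of_acceptingHalt h₂')
    exact (not_step_of_acceptingHalt h₂' _ h₁').elim
  | some _, none, some w₂, ⟨u₁, h₁, h₁'⟩, ⟨u₂, h₂, h₂'⟩ => by
    obtain rfl := stays_unique hM h₁ h₂ (not_step_of_acceptingHalt h₁') (not_stay_of_right hM h₂')
    exact (not_step_of_acceptingHalt h₁' _ h₂').elim

end WorkConfig

end OnlineTM

/-! ## The bounds -/

namespace OnlineTM

open WorkConfig

variable {M : OnlineTM}

open Classical in
/-- The transitions of the automaton that simulates `M` in space `s`. -/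
noncomputable def transitions (M : OnlineTM) (s : ℕ) [Fintype (BoundedState M s)] :
    Finset (BoundedState M s × Bool × BoundedState M s) :=
  Finset.univ.filter fun e => BitStep e.2.1 e.1.toOption e.2.2.toOption

theorem card_transitions_le (M : OnlineTM) (s : ℕ) [Fintype (BoundedState M s)] :
    (transitions M s).card ≤ 2 * Fintype.card (BoundedState M s) ^ 2 := by
  refine (Finset.card_le_univ _).trans_eq ?_
  rw [Fintype.card_prod, Fintype.card_prod, Fintype.card_bool]
  ring

theorem card_transitions_le_of_deterministic (hM : M.Deterministic) (s : ℕ)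
    [Fintype (BoundedState M s)] :
    (transitions M s).card ≤ 2 * Fintype.card (BoundedState M s) := by
  have h : (transitions M s).card ≤ (Finset.univ : Finset (BoundedState M s × Bool)).card := by
    refine Finset.card_le_card_of_injOn (fun e => (e.1, e.2.1)) (fun _ _ => Finset.mem_univ _) ?_
    rintro ⟨v, b, v₁⟩ h₁ ⟨v', b', v₂⟩ h₂ h
    simp only [Prod.mk.injEq] at h
    obtain ⟨rfl, rfl⟩ := h
    simp only [transitions, Finset.coe_filter, Finset.mem_univ, true_and, Set.mem_ofPred_eq]
      at h₁ h₂
    obtain rfl := Option.map_injective Subtype.val_injective (bitStep_unique hM h₁ h₂)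
    rfl
  refine h.trans_eq ?_
  rw [Finset.card_univ, Fintype.card_prod, Fintype.card_bool, mul_comm]

theorem card_boundedState_le (M : OnlineTM) {s : ℕ} (hs : 0 < s) [Fintype (BoundedState M s)] :
    Fintype.card (BoundedState M s) ≤ 2 * (Nat.card M.State * (2 ^ s * s)) := by
  have := M.finite_state
  have : Nonempty M.State := ⟨M.start⟩
  have hpos : 0 < Nat.card M.State * (2 ^ s * s) := by
    have := Nat.card_pos (α := M.State)
    positivity
  have := card_fits_le M s
  rw [← Nat.card_eq_fintype_card, Finite.card_option]
  omega

theorem UsesSpace.pos {s : ℕ → ℕ} (hs : M.UsesSpace s) (n : ℕ) : 0 < s n := by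
  have := hs (List.replicate n false) _ .refl
  rw [List.length_replicate] at this
  omega

theorem UsesSpace.exists_hasExtendedFormulation {s : ℕ → ℕ} (hs : M.UsesSpace s) (n : ℕ)
    [Fintype (BoundedState M (s n))] :
    ∃ r ≤ n * (transitions M (s n)).card + 1,
      HasExtendedFormulation (languagePolytope M.language n) r := by
  classical
  -- The initial work configuration does not depend on the input, so the empty input serves for all
  -- words.
  let w : Fits (M := M) (s n) := ⟨(M.init []).work, hs.pos n, fun _ _ => rfl⟩
  have h := exists_hasExtendedFormulation_acceptedWords (transitions M (s n)) (some w)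
    {v | AcceptsAtEnd v.toOption} n
  suffices heq : {x : Fin n → Bool | List.ofFn x ∈ M.language} =
      acceptedWords (transitions M (s n)) (some w) {v | AcceptsAtEnd v.toOption} n by
    rwa [languagePolytope, heq]
  ext x
  have hx : ∀ c, M.Reaches (List.ofFn x) c → c.head < s n := by
    intro c hc
    simpa using hs _ c hc
  change M.Accepts (List.ofFn x) ↔ _
  rw [accepts_iff_boundedAccepts hx w rfl, boundedAccepts_ofFn_iff]
  simp [acceptedWords, transitions]

end OnlineTM

/-- Length zero is excluded because the target bounds carry a factor `n` and vanish there. -/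
theorem xcIsBigO_of_hasExtendedFormulation {L : Language Bool} {f : ℕ → ℝ≥0} (C : ℕ)
    (hC : 0 < C) (g : ℕ → ℕ) (hfg : ∀ n, f n = g n)
    (h : ∀ n, 0 < n → ∃ r ≤ C * g n, HasExtendedFormulation (languagePolytope L n) r) :
    XcIsBigO L f := by
  refine ⟨C, by exact_mod_cast hC, 1, fun n hn => ?_⟩
  obtain ⟨r, hr, hext⟩ := h n hn
  have h1 : xc (languagePolytope L n) ≤ (r : ℕ∞) := iInf₂_le r hext
  calc ((xc (languagePolytope L n) : ℕ∞) : ℝ≥0∞) ≤ ((r : ℕ∞) : ℝ≥0∞) :=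
        ENat.toENNReal_le.2 h1
    _ = (r : ℝ≥0∞) := by simp
    _ ≤ ((C * g n : ℕ) : ℝ≥0∞) := by exact_mod_cast hr
    _ = ((C * f n : ℝ≥0) : ℝ≥0∞) := by rw [hfg]; push_cast; rfl

open OnlineTM WorkConfig in
theorem mainTheorem1 (s : ℕ → ℕ) (L : Language Bool) :
    (L ∈ OnePassNSPACE s →
      XcIsBigO L (fun n => (4 : ℝ≥0) ^ s n * (s n : ℝ≥0) ^ 2 * (n : ℝ≥0))) ∧
    (L ∈ OnePassDSPACE s →
      XcIsBigO L (fun n => (2 : ℝ≥0) ^ s n * (s n : ℝ≥0) * (n : ℝ≥0))) := by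
  have hcard : ∀ M : OnlineTM, 0 < Nat.card M.State := fun M => by
    have := M.finite_state
    have : Nonempty M.State := ⟨M.start⟩
    exact Nat.card_pos
  constructor
  · rintro ⟨M, hs, rfl⟩
    have hq := hcard M
    -- `9 = 2 * 2 ^ 2 + 1`: two bits, the squared factor 2 that pays for the extra state, and the `+
    -- 1` absorbed by `hone`.
    refine xcIsBigO_of_hasExtendedFormulation (9 * Nat.card M.State ^ 2) (by positivity)
      (fun n => 4 ^ s n * s n ^ 2 * n) (fun n => by push_cast; rfl) fun n hn => ?_
    have := Fintype.ofFinite (BoundedState M (s n))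
    obtain ⟨r, hr, hext⟩ := hs.exists_hasExtendedFormulation n
    refine ⟨r, hr.trans ?_, hext⟩
    have hpos := hs.pos n
    have hone : 1 ≤ Nat.card M.State ^ 2 * (4 ^ s n * s n ^ 2 * n) :=
      Nat.one_le_iff_ne_zero.2 (by positivity)
    calc n * (transitions M (s n)).card + 1
        ≤ n * (2 * (2 * (Nat.card M.State * (2 ^ s n * s n))) ^ 2) +
          Nat.card M.State ^ 2 * (4 ^ s n * s n ^ 2 * n) := by
          gcongr
          exact (card_transitions_le M (s n)).trans (by gcongr; exact card_boundedState_le M hpos)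
      _ = 9 * Nat.card M.State ^ 2 * (4 ^ s n * s n ^ 2 * n) := by
          rw [show 4 ^ s n = (2 ^ s n) ^ 2 by rw [← pow_mul, mul_comm, pow_mul]; norm_num]
          ring
  · rintro ⟨M, hM, hs, rfl⟩
    have hq := hcard M
    -- `5 = 2 * 2 + 1`, with the state count now entering linearly.
    refine xcIsBigO_of_hasExtendedFormulation (5 * Nat.card M.State) (by positivity)
      (fun n => 2 ^ s n * s n * n) (fun n => by push_cast; rfl) fun n hn => ?_
    have := Fintype.ofFinite (BoundedState M (s n))
    obtain ⟨r, hr, hext⟩ := hs.exists_hasExtendedFormulation n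
    refine ⟨r, hr.trans ?_, hext⟩
    have hpos := hs.pos n
    have hone : 1 ≤ Nat.card M.State * (2 ^ s n * s n * n) :=
      Nat.one_le_iff_ne_zero.2 (by positivity)
    calc n * (transitions M (s n)).card + 1
        ≤ n * (2 * (2 * (Nat.card M.State * (2 ^ s n * s n)))) +
          Nat.card M.State * (2 ^ s n * s n * n) := by
          gcongr
          exact (card_transitions_le_of_deterministic hM (s n)).trans
            (by gcongr; exact card_boundedState_le M hpos)
      _ = 5 * Nat.card M.State * (2 ^ s n * s n * n) := by ring
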